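/- Let $\mathcal C$ be a semi-abelian category (pointed, with binary coproducts, Barr exact and protomodular) and let $B$ be an object of $\mathcal C$. For objects $B, X$ let $B\flat X$ be the kernel of $[0,1]\colon X+B\to B$; an internal action of $B$ on $X$ is an algebra structure $\xi\colon B\flat X\to X$ for the monad $B\flat(-)$, and its semidirect product $X\rtimes B$ is the pushout of $B\flat X\to X+B$ along $\xi$, with canonical morphisms $j\colon X\to X\rtimes B$ and $i\colon B\to X\rtimes B$. A pre-crossed module over $B$ is a morphism $\delta\colon X\to B$ together with an internal action of $B$ on $X$ for which $\delta$ is equivariant, $B$ acting on itself by conjugation; with equivariant morphisms over $B$ these form a category $\mathbf{PXMod}_B(\mathcal C)$, whose coproduct is denoted $X\oplus Y$. For pre-crossed modules $X,Y$ over $B$, let $Y$ act on $X$ through $\delta_Y$ and let $X\rtimes Y$ be the semidirect product. It is the pullback of $X\rtimes B\to B$ along $\delta_Y$, and it is a pre-crossed module over $B$: its morphism to $B$ is the one restricting to $\delta_X$ and $\delta_Y$, and $B$ acts on it by the given action in the component $Y$ and by conjugation through $i\colon B\to X\rtimes B$ in the component $X\rtimes B$. Then $j_X\colon X\to X\rtimes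 Y$ and $i_Y\colon Y\to X\rtimes Y$ are morphisms of pre-crossed modules; symmetrically one has $Y\rtimes X$ with $i_X$ and $j_Y$. The Peiffer product $X\bowtie Y$ is the pushout in $\mathbf{PXMod}_B(\mathcal C)$ of $[j_X,i_Y]\colon X\oplus Y\to X\rtimes Y$ and $[i_X,j_Y]\colon X\oplus Y\to Y\rtimes X$; let $l_X\colon X\to X\bowtie Y$ and $l_Y\colon Y\to X\bowtie Y$ be the composites of the coproduct injections with $X\oplus Y\to X\bowtie Y$. If $m\colon X\to A$ and $n\colon Y\to A$ are subobjects (monomorphisms) in $\mathbf{PXMod}_B(\mathcal C)$, the Peiffer commutator $\langle X,Y\rangle$ is the image under $[m,n]\colon X\oplus Y\to A$ of the join in $\mathbf{PXMod}_B(\mathcal C)$ of the kernels of $[j_X,i_Y]$ and $[i_X,j_Y]$. Then the following are equivalent: 1. $\langle X,Y\rangle=0$; 2. there exists a morphism $\varphi\colon X\bowtie Y\to A$ in $\mathbf{PXMod}_B(\mathcal C)$ such that $\varphi\, l_X=m$ and $\varphi\, l_Y=n$. Moreover, such a morphism $\varphi$ is necessarily unique. -/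

import Mathlib

open CategoryTheory CategoryTheory.Limits

universe v u

namespace Peiffer

section Main

attribute [local simp] pullback.lift_fst pullback.lift_snd pullback.lift_fst_assoc
  pullback.lift_snd_assoc prod.lift_fst prod.lift_snd prod.lift_fst_assoc prod.lift_snd_assoc
  coprod.inl_desc coprod.inr_desc coprod.inl_desc_assoc coprod.inr_desc_assoc
  pushout.inl_desc pushout.inr_desc pushout.inl_desc_assoc pushout.inr_desc_assoc

section Base

variable {C : Type u} [Category.{v} C] [HasZeroMorphisms C]

/-- `k` is a kernel of `p`. -/
def IsKernelOf {K A B : C} (k : K ⟶ A) (p : A ⟶ B) : Prop :=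
  ∃ w : k ≫ p = 0, Nonempty (IsLimit (KernelFork.ofι k w))

end Base

/-- A semi-abelian category: it is pointed (zero object and zero morphisms), has binary coproducts,
is Barr exact (regular, and every internal equivalence relation is a kernel pair), and is
protomodular (which, for a pointed category with finite limits, is the split short five lemma). -/
class SemiAbelian (C : Type u) [Category.{v} C] [HasZeroMorphisms C] : Prop
    extends Regular C, HasZeroObject C where
  hasBinaryCoproducts : HasBinaryCoproducts C
  effective : ∀ {R A : C} (p₁ p₂ : R ⟶ A), IsEquivalenceRelation p₁ p₂ →
    ∃ (Q : C) (q : A ⟶ Q), IsKernelPair q p₁ p₂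
  split_short_five : ∀ {K A B K' A' B' : C} (k : K ⟶ A) (p : A ⟶ B) (s : B ⟶ A)
    (k' : K' ⟶ A') (p' : A' ⟶ B') (s' : B' ⟶ A') (a : K ⟶ K') (f : A ⟶ A') (b : B ⟶ B'),
    s ≫ p = 𝟙 B → s' ≫ p' = 𝟙 B' → IsKernelOf k p → IsKernelOf k' p' →
    k ≫ f = a ≫ k' → f ≫ p' = p ≫ b → s ≫ f = b ≫ s' → IsIso a → IsIso b → IsIso f

attribute [instance] SemiAbelian.hasBinaryCoproducts

section Exact

variable {C : Type u} [Category.{v} C] [HasZeroMorphisms C]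

theorem IsKernelOf.w {K A B : C} {k : K ⟶ A} {p : A ⟶ B} (h : IsKernelOf k p) : k ≫ p = 0 := h.1

theorem IsKernelOf.mono {K A B : C} {k : K ⟶ A} {p : A ⟶ B} (h : IsKernelOf k p) : Mono k := by
  obtain ⟨w, ⟨l⟩⟩ := h
  exact mono_of_isLimit_fork l

theorem IsKernelOf.exists_lift {K A B Z : C} {k : K ⟶ A} {p : A ⟶ B} (h : IsKernelOf k p)
    (z : Z ⟶ A) (hz : z ≫ p = 0) : ∃ t : Z ⟶ K, t ≫ k = z := by
  obtain ⟨w, ⟨l⟩⟩ := h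
  exact ⟨_, (KernelFork.IsLimit.lift' l z hz).2⟩

theorem IsKernelOf.mk' {K A B : C} {k : K ⟶ A} {p : A ⟶ B} [Mono k] (w : k ≫ p = 0)
    (h : ∀ {Z : C} (z : Z ⟶ A), z ≫ p = 0 → ∃ t : Z ⟶ K, t ≫ k = z) : IsKernelOf k p :=
  ⟨w, ⟨KernelFork.IsLimit.ofι' k w fun z hz => ⟨(h z hz).choose, (h z hz).choose_spec⟩⟩⟩

theorem isKernelOf_kernel {A B : C} (p : A ⟶ B) [HasKernel p] : IsKernelOf (kernel.ι p) p :=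
  ⟨kernel.condition p, ⟨kernelIsKernel p⟩⟩

/-- A map of kernels over a fixed base is a pullback. -/
theorem isPullback_of_kernels {K A K' A' B : C} {k : K ⟶ A} {p : A ⟶ B} {k' : K' ⟶ A'}
    {p' : A' ⟶ B} {a : K ⟶ K'} {f : A ⟶ A'} (hk : IsKernelOf k p) (hk' : IsKernelOf k' p')
    (h : a ≫ k' = k ≫ f) (hf : f ≫ p' = p) : IsPullback a k k' f := by
  have := hk.mono
  have := hk'.mono
  refine ⟨⟨h⟩, ⟨PullbackCone.isLimitAux' _ fun s => ?_⟩⟩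
  have hs : s.snd ≫ p = 0 := by
    rw [← hf, ← Category.assoc, ← s.condition, Category.assoc, hk'.w, comp_zero]
  have ht := hk.exists_lift s.snd hs
  refine ⟨ht.choose, ?_, ht.choose_spec, fun {m} _ h2 => ?_⟩
  · change ht.choose ≫ a = _
    rw [← cancel_mono k', Category.assoc, h, ← Category.assoc, ht.choose_spec, s.condition]
  · exact (cancel_mono k).1 (h2.trans ht.choose_spec.symm)

variable [SemiAbelian C]

/-- In a point, the kernel and the section are jointly extremally epimorphic. -/
theorem point_isIso {K A B M : C} {k : K ⟶ A} {p : A ⟶ B} {s : B ⟶ A} (hs : s ≫ p = 𝟙 B)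
    (hk : IsKernelOf k p) (m : M ⟶ A) [Mono m] (k' : K ⟶ M) (s' : B ⟶ M) (h1 : k' ≫ m = k)
    (h2 : s' ≫ m = s) : IsIso m := by
  have := hk.mono
  have hm : Mono (k' ≫ m) := by rw [h1]; infer_instance
  have : Mono k' := mono_of_mono k' m
  refine SemiAbelian.split_short_five k' (m ≫ p) s' k p s (𝟙 _) m (𝟙 _)
    (by rw [← Category.assoc, h2, hs]) hs ?_ hk (by simp [h1]) (by simp) (by simp [h2])
    inferInstance inferInstance
  refine IsKernelOf.mk' (by rw [← Category.assoc, h1, hk.w]) fun z hz => ?_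
  obtain ⟨t, ht⟩ := hk.exists_lift (z ≫ m) (by rw [Category.assoc, hz])
  exact ⟨t, by rw [← cancel_mono m, Category.assoc, h1, ht]⟩

theorem mono_of_isZero_kernel {A A' : C} (f : A ⟶ A')
    (h : ∀ {Z : C} (z : Z ⟶ A), z ≫ f = 0 → z = 0) : Mono f := by
  let _ := HasZeroObject.zero' C
  let s : A ⟶ pullback f f := pullback.lift (𝟙 _) (𝟙 _) rfl
  have hs : s ≫ pullback.fst f f = 𝟙 _ := by simp [s]
  have : IsSplitMono s := ⟨⟨⟨_, hs⟩⟩⟩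
  have hk : IsKernelOf (0 : (0 : C) ⟶ pullback f f) (pullback.fst f f) := by
    have : Mono (0 : (0 : C) ⟶ pullback f f) := ⟨fun _ _ _ => (isZero_zero C).eq_of_tgt _ _⟩
    refine IsKernelOf.mk' (by simp) fun z hz => ⟨0, ?_⟩
    apply pullback.hom_ext
    · simp [hz]
    · have := h (z ≫ pullback.snd f f) (by
        rw [Category.assoc, ← pullback.condition, ← Category.assoc, hz, zero_comp])
      simp [this]
  have : IsIso s := point_isIso hs hk s 0 (𝟙 _) (by simp) (by simp)
  refine (IsKernelPair.of_hasPullback f).mono_of_eq_fst_snd ?_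
  rw [← cancel_epi s]
  simp [s]

/-- Internal relations in a semi-abelian category are difunctional. -/
theorem difunctional {R X Y Z : C} (d : R ⟶ X) (c : R ⟶ Y) (hR : JointlyMono₂ d c)
    (r₁ r₂ r₃ : Z ⟶ R) (h₁ : r₁ ≫ c = r₂ ≫ c) (h₂ : r₂ ≫ d = r₃ ≫ d) :
    ∃ r : Z ⟶ R, r ≫ d = r₁ ≫ d ∧ r ≫ c = r₃ ≫ c := by
  let x₂ : pullback c c ⟶ R := pullback.snd c c
  let p := pullback.fst (x₂ ≫ d) d
  let y₁ := p ≫ pullback.fst c c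
  let y₂ := p ≫ pullback.snd c c
  let y₃ := pullback.snd (x₂ ≫ d) d
  have hy12 : y₁ ≫ c = y₂ ≫ c := by simp [y₁, y₂, pullback.condition]
  have hy23 : y₂ ≫ d = y₃ ≫ d := by
    have := pullback.condition (f := x₂ ≫ d) (g := d)
    simpa [y₂, y₃, p, x₂] using this
  let s : pullback c c ⟶ pullback (x₂ ≫ d) d := pullback.lift (𝟙 _) x₂ (by simp)
  have hs : s ≫ p = 𝟙 _ := by simp [s, p]
  let l : R ⟶ X ⨯ Y := prod.lift d c
  have hl : Mono l := ⟨fun f g h => hR.right_cancellation f g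
    (by simpa [l] using congr($h ≫ prod.fst)) (by simpa [l] using congr($h ≫ prod.snd))⟩
  let b := prod.lift (y₁ ≫ d) (y₃ ≫ c)
  let m := pullback.fst b l
  have hm : IsIso m := by
    have e₁ : kernel.ι p ≫ b = (kernel.ι p ≫ y₃) ≫ l := by
      ext
      · simp [b, l, y₁, ← hy23, y₂]
      · simp [b, l]
    have e₂ : s ≫ b = (s ≫ y₁) ≫ l := by
      ext
      · simp [b, l]
      · simp [b, l, hy12]
        simp [s, y₃, y₂, p, x₂]
    exact point_isIso hs (isKernelOf_kernel p) m
      (pullback.lift (kernel.ι p) (kernel.ι p ≫ y₃) e₁)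
      (pullback.lift s (s ≫ y₁) e₂) (by simp [m]) (by simp [m])
  let w : Z ⟶ pullback (x₂ ≫ d) d :=
    pullback.lift (pullback.lift r₁ r₂ h₁) r₃ (by simp [x₂, h₂])
  have hc := pullback.condition (f := b) (g := l)
  refine ⟨w ≫ inv m ≫ pullback.snd b l, ?_, ?_⟩
  · have := congr(w ≫ inv m ≫ $hc ≫ prod.fst)
    simp only [b, l, Category.assoc, prod.lift_fst] at this
    simp only [Category.assoc]
    rw [← this]
    change w ≫ inv m ≫ m ≫ y₁ ≫ d = _
    simp [w, y₁, p]
  · have := congr(w ≫ inv m ≫ $hc ≫ prod.snd)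
    simp only [b, l, Category.assoc, prod.lift_snd] at this
    simp only [Category.assoc]
    rw [← this]
    change w ≫ inv m ≫ m ≫ y₃ ≫ c = _
    simp [w, y₃]

/-- Coequalizers of reflexive pairs, with the description of their kernel pairs. -/
theorem reflexive_coequalizer {A X : C} (f g : A ⟶ X) (s : X ⟶ A) (hf : s ≫ f = 𝟙 X)
    (hg : s ≫ g = 𝟙 X) :
    ∃ (Q : C) (q : X ⟶ Q) (w : f ≫ q = g ≫ q), Nonempty (IsColimit (Cofork.ofπ q w)) ∧
      ∀ {Z : C} (a b : Z ⟶ X), a ≫ q = b ≫ q →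
        ∃ (Z' : C) (e : Z' ⟶ Z) (t : Z' ⟶ A), Epi e ∧ t ≫ f = e ≫ a ∧ t ≫ g = e ≫ b := by
  obtain ⟨I, m, e, hem, hm, he⟩ : ∃ (I : C) (m : I ⟶ X ⨯ X) (e : A ⟶ I),
      e ≫ m = prod.lift f g ∧ Mono m ∧ IsRegularEpi e :=
    let F := Regular.strongEpiMonoFactorisation (prod.lift f g)
    ⟨F.I, F.m, F.e, F.fac, inferInstance, inferInstanceAs
      (IsRegularEpi (Regular.strongEpiMonoFactorisation (prod.lift f g)).e)⟩
  obtain ⟨p₁, hp₁⟩ : ∃ p : I ⟶ X, p = m ≫ prod.fst := ⟨_, rfl⟩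
  obtain ⟨p₂, hp₂⟩ : ∃ p : I ⟶ X, p = m ≫ prod.snd := ⟨_, rfl⟩
  have hF₁ : e ≫ p₁ = f := by simp [hp₁, reassoc_of% hem]
  have hF₂ : e ≫ p₂ = g := by simp [hp₂, reassoc_of% hem]
  have hj : JointlyMono₂ p₁ p₂ := ⟨fun _ a b h1 h2 => by
    rw [← cancel_mono m]
    ext
    · simpa [hp₁] using h1
    · simpa [hp₂] using h2⟩
  have hr₁ : (s ≫ e) ≫ p₁ = 𝟙 X := by rw [Category.assoc, hF₁, hf]
  have hr₂ : (s ≫ e) ≫ p₂ = 𝟙 X := by rw [Category.assoc, hF₂, hg]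
  have hsym := difunctional p₁ p₂ hj (p₂ ≫ s ≫ e) (𝟙 _) (p₁ ≫ s ≫ e)
    (by rw [Category.assoc, hr₂]; simp) (by rw [Category.assoc, hr₁]; simp)
  have htr := difunctional p₁ p₂ hj (pullback.fst p₂ p₁) (pullback.fst p₂ p₁ ≫ p₂ ≫ s ≫ e)
    (pullback.snd p₂ p₁) (by simp only [Category.assoc, hr₂]; simp)
    (by simp only [Category.assoc, hr₁]; simp [pullback.condition])
  obtain ⟨σ, hσ₁, hσ₂⟩ := hsym
  obtain ⟨τ, hτ₁, hτ₂⟩ := htr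
  have heq : IsEquivalenceRelation p₁ p₂ := ⟨⟨
    { toJointlyMono₂ := hj
      r := s ≫ e
      reflexivity₁ := hr₁
      reflexivity₂ := hr₂
      s := σ
      symmetry₁ := by rw [hσ₁, Category.assoc, hr₁, Category.comp_id]
      symmetry₂ := by rw [hσ₂, Category.assoc, hr₂, Category.comp_id]
      c := _
      isLimit := pullbackIsPullback p₂ p₁
      t := τ
      transitivity₁ := hτ₁
      transitivity₂ := hτ₂ }⟩⟩
  obtain ⟨Q', q', hq'⟩ := SemiAbelian.effective p₁ p₂ heq
  have := Regular.hasCoequalizer_of_isKernelPair hq'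
  have hkp : IsKernelPair (coequalizer.π p₁ p₂) p₁ p₂ :=
    IsKernelPair.cancel_right (f₂ := coequalizer.desc q' hq'.w) (coequalizer.condition p₁ p₂)
      (by simpa using hq')
  have hw : f ≫ coequalizer.π p₁ p₂ = g ≫ coequalizer.π p₁ p₂ := by
    have := congr(e ≫ $(coequalizer.condition p₁ p₂))
    rwa [← Category.assoc, ← Category.assoc, hF₁, hF₂] at this
  refine ⟨_, coequalizer.π p₁ p₂, hw, ⟨?_⟩, ?_⟩
  · refine Cofork.IsColimit.mk' _ fun c => ?_
    have hc : p₁ ≫ c.π = p₂ ≫ c.π := by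
      rw [← cancel_epi e, ← Category.assoc, ← Category.assoc, hF₁, hF₂, c.condition]
    exact ⟨coequalizer.desc c.π hc, coequalizer.π_desc _ _,
      fun {m} hm => coequalizer.hom_ext (hm.trans (coequalizer.π_desc _ _).symm)⟩
  · intro Z a b hab
    refine ⟨pullback (hkp.lift a b hab) e, pullback.fst _ _, pullback.snd _ _, ?_, ?_, ?_⟩
    · infer_instance
    · rw [← hF₁, ← Category.assoc, ← pullback.condition]; simp
    · rw [← hF₂, ← Category.assoc, ← pullback.condition]; simp

instance : HasCoequalizers C := by
  suffices ∀ {X Y : C} {f g : X ⟶ Y}, HasColimit (parallelPair f g) from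
    hasCoequalizers_of_hasColimit_parallelPair C
  intro X Y f g
  obtain ⟨Q, q, w, ⟨hq⟩, -⟩ := reflexive_coequalizer (coprod.desc f (𝟙 Y)) (coprod.desc g (𝟙 Y))
    coprod.inr (by simp) (by simp)
  have w' : f ≫ q = g ≫ q := by simpa using congr(coprod.inl ≫ $w)
  refine ⟨⟨⟨Cofork.ofπ q w', Cofork.IsColimit.mk' _ fun c => ?_⟩⟩⟩
  have hc : coprod.desc f (𝟙 Y) ≫ c.π = coprod.desc g (𝟙 Y) ≫ c.π := by
    ext <;> simp [c.condition]
  exact ⟨hq.desc (Cofork.ofπ c.π hc), hq.fac _ WalkingParallelPair.one,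
    fun {m} hm => Cofork.IsColimit.hom_ext hq
      (by simpa using hm.trans (hq.fac (Cofork.ofπ c.π hc) WalkingParallelPair.one).symm)⟩

instance : HasPushouts C := hasPushouts_of_hasBinaryCoproducts_of_hasCoequalizers C

end Exact

section Flat

variable {C : Type u} [Category.{v} C] [HasZeroMorphisms C] [SemiAbelian C]

/-- The object `B ♭ X`, the kernel of `[0, 1] : X + B ⟶ B`. -/
noncomputable def flat (B X : C) : C := kernel (coprod.desc 0 (𝟙 B) : X ⨿ B ⟶ B)

/-- The kernel inclusion `B ♭ X ⟶ X + B`. -/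
noncomputable def flatIncl (B X : C) : flat B X ⟶ X ⨿ B :=
  kernel.ι (coprod.desc 0 (𝟙 B) : X ⨿ B ⟶ B)

theorem flatIncl_isKernelOf (B X : C) :
    IsKernelOf (flatIncl B X) (coprod.desc 0 (𝟙 B) : X ⨿ B ⟶ B) := isKernelOf_kernel _

instance (B X : C) : Mono (flatIncl B X) := (flatIncl_isKernelOf B X).mono

theorem flatIncl_w (B X : C) : flatIncl B X ≫ (coprod.desc 0 (𝟙 B) : X ⨿ B ⟶ B) = 0 :=
  (flatIncl_isKernelOf B X).w

theorem flatIncl_desc_zero {B X Z : C} (g : B ⟶ Z) :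
    flatIncl B X ≫ (coprod.desc 0 g : X ⨿ B ⟶ Z) = 0 := by
  have : (coprod.desc 0 g : X ⨿ B ⟶ Z) = coprod.desc 0 (𝟙 B) ≫ g := by ext <;> simp
  rw [this, ← Category.assoc, flatIncl_w, zero_comp]

/-- The morphism to `B ♭ X` induced by a morphism to `X + B`. -/
noncomputable def flatLift {B X Z : C} (z : Z ⟶ X ⨿ B) (hz : z ≫ coprod.desc 0 (𝟙 B) = 0) :
    Z ⟶ flat B X :=
  kernel.lift _ z hz

@[simp]
theorem flatLift_incl {B X Z : C} (z : Z ⟶ X ⨿ B) (hz : z ≫ coprod.desc 0 (𝟙 B) = 0) :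
    flatLift z hz ≫ flatIncl B X = z := kernel.lift_ι _ _ _

@[simp]
theorem flatLift_incl_assoc {B X Z W : C} (z : Z ⟶ X ⨿ B) (hz : z ≫ coprod.desc 0 (𝟙 B) = 0)
    (w : X ⨿ B ⟶ W) : flatLift z hz ≫ flatIncl B X ≫ w = z ≫ w := by
  rw [← Category.assoc, flatLift_incl]

/-- The functorial action `b ♭ x : B ♭ X ⟶ B' ♭ X'`. -/
noncomputable def flatMap {B B' X X' : C} (b : B ⟶ B') (x : X ⟶ X') : flat B X ⟶ flat B' X' :=
  flatLift (flatIncl B X ≫ coprod.map x b) (by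
    rw [Category.assoc, coprod.map_desc, comp_zero, Category.comp_id, flatIncl_desc_zero])

/-- The unit `X ⟶ B ♭ X` of the monad `B ♭ (-)`. -/
noncomputable def flatUnit (B X : C) : X ⟶ flat B X := flatLift coprod.inl (by simp)

/-- The multiplication `B ♭ (B ♭ X) ⟶ B ♭ X` of the monad `B ♭ (-)`. -/
noncomputable def flatMul (B X : C) : flat B (flat B X) ⟶ flat B X :=
  flatLift (flatIncl B (flat B X) ≫ coprod.desc (flatIncl B X) coprod.inr) (by
    rw [Category.assoc, coprod.desc_comp, flatIncl_w, coprod.inr_desc, flatIncl_w])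

/-- The conjugation action `B ♭ B ⟶ B` of `B` on itself, the restriction of `[1, 1]`. -/
noncomputable def conj (B : C) : flat B B ⟶ B := flatIncl B B ≫ coprod.desc (𝟙 B) (𝟙 B)

@[simp]
theorem flatMap_incl {B B' X X' : C} (b : B ⟶ B') (x : X ⟶ X') :
    flatMap b x ≫ flatIncl B' X' = flatIncl B X ≫ coprod.map x b := flatLift_incl _ _

@[simp]
theorem flatMap_incl_assoc {B B' X X' W : C} (b : B ⟶ B') (x : X ⟶ X') (w : X' ⨿ B' ⟶ W) :
    flatMap b x ≫ flatIncl B' X' ≫ w = flatIncl B X ≫ coprod.map x b ≫ w := by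
  rw [← Category.assoc, flatMap_incl, Category.assoc]

@[simp]
theorem flatUnit_incl (B X : C) : flatUnit B X ≫ flatIncl B X = coprod.inl := flatLift_incl _ _

@[simp]
theorem flatUnit_incl_assoc {B X W : C} (w : X ⨿ B ⟶ W) :
    flatUnit B X ≫ flatIncl B X ≫ w = coprod.inl ≫ w := flatLift_incl_assoc _ _ _

@[simp]
theorem flatMul_incl (B X : C) : flatMul B X ≫ flatIncl B X =
    flatIncl B (flat B X) ≫ coprod.desc (flatIncl B X) coprod.inr := flatLift_incl _ _

@[simp]
theorem flatMul_incl_assoc {B X W : C} (w : X ⨿ B ⟶ W) : flatMul B X ≫ flatIncl B X ≫ w =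
    flatIncl B (flat B X) ≫ coprod.desc (flatIncl B X) coprod.inr ≫ w := by
  rw [← Category.assoc, flatMul_incl, Category.assoc]

@[simp]
theorem flatMap_id (B X : C) : flatMap (𝟙 B) (𝟙 X) = 𝟙 (flat B X) := by
  rw [← cancel_mono (flatIncl B X)]; simp

@[simp]
theorem flatMap_zero {B B' X X' : C} (b : B ⟶ B') :
    flatMap b (0 : X ⟶ X') = 0 := by
  rw [← cancel_mono (flatIncl B' X'), flatMap_incl, zero_comp]
  have : coprod.map (0 : X ⟶ X') b = coprod.desc 0 (b ≫ coprod.inr) := by ext <;> simp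
  rw [this, flatIncl_desc_zero]

theorem flatMap_comp {B B' B'' X X' X'' : C} (b : B ⟶ B') (x : X ⟶ X') (b' : B' ⟶ B'')
    (x' : X' ⟶ X'') : flatMap b x ≫ flatMap b' x' = flatMap (b ≫ b') (x ≫ x') := by
  rw [← cancel_mono (flatIncl B'' X'')]; simp

theorem flatMap_comp_assoc {B B' B'' X X' X'' W : C} (b : B ⟶ B') (x : X ⟶ X') (b' : B' ⟶ B'')
    (x' : X' ⟶ X'') (w : flat B'' X'' ⟶ W) :
    flatMap b x ≫ flatMap b' x' ≫ w = flatMap (b ≫ b') (x ≫ x') ≫ w := by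
  rw [← Category.assoc, flatMap_comp]

theorem flatUnit_naturality {B B' X X' : C} (b : B ⟶ B') (x : X ⟶ X') :
    flatUnit B X ≫ flatMap b x = x ≫ flatUnit B' X' := by
  rw [← cancel_mono (flatIncl B' X')]; simp

theorem flatMul_naturality {B B' X X' : C} (b : B ⟶ B') (x : X ⟶ X') :
    flatMul B X ≫ flatMap b x = flatMap b (flatMap b x) ≫ flatMul B' X' := by
  rw [← cancel_mono (flatIncl B' X')]; simp

theorem conj_naturality {B B' : C} (b : B ⟶ B') :
    conj B ≫ b = flatMap b b ≫ conj B' := by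
  simp [conj]

theorem conj_unit (B : C) : flatUnit B B ≫ conj B = 𝟙 B := by simp [conj]

theorem conj_assoc (B : C) : flatMap (𝟙 B) (conj B) ≫ conj B = flatMul B B ≫ conj B := by
  simp [conj]

/-- `1 ♭ x` is a regular epimorphism when `x` is. -/
theorem isRegularEpi_flatMap {B X X' : C} (x : X ⟶ X') [IsRegularEpi x] :
    IsRegularEpi (flatMap (𝟙 B) x) := by
  have h : StrongEpi (coprod.map x (𝟙 B)) := by
    have : Epi (coprod.map x (𝟙 B)) := inferInstance
    refine StrongEpi.mk' fun W V z hz a b sq => ?_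
    have sq₁ : CommSq (coprod.inl ≫ a) x z (coprod.inl ≫ b) := ⟨by simp [sq.w]⟩
    refine ⟨⟨⟨coprod.desc sq₁.lift (coprod.inr ≫ a), ?_, ?_⟩⟩⟩
    · ext <;> simp
    · ext
      · simp
      · simp [sq.w]
  have h' : IsRegularEpi (coprod.map x (𝟙 B)) := inferInstance
  exact Regular.regularEpiIsStableUnderBaseChange.of_isPullback
    (isPullback_of_kernels (flatIncl_isKernelOf B X) (flatIncl_isKernelOf B X')
    (flatMap_incl (𝟙 B) x) (by ext <;> simp)).flip h'

/-- An internal action of `B` on `X`: an algebra structure on `X` for the monad `B ♭ (-)`. -/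
structure InternalAction (B X : C) where
  map : flat B X ⟶ X
  unit : flatUnit B X ≫ map = 𝟙 X
  assoc : flatMap (𝟙 B) map ≫ map = flatMul B X ≫ map

namespace InternalAction

variable {B X : C}

/-- The pullback `g^* ξ` of an action `ξ` of `B` along `g : Y ⟶ B`. -/
noncomputable def restrict (ξ : InternalAction B X) {Y : C} (g : Y ⟶ B) : InternalAction Y X where
  map := flatMap g (𝟙 X) ≫ ξ.map
  unit := by rw [← Category.assoc, flatUnit_naturality]; simp [ξ.unit]
  assoc := by
    rw [← Category.assoc (flatMul Y X), flatMul_naturality, Category.assoc, ← ξ.assoc]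
    simp only [← Category.assoc, flatMap_comp, Category.comp_id, Category.id_comp]

variable (ξ : InternalAction B X)

/-- The semidirect product `X ⋊ B` of the action `ξ`: the pushout of `B ♭ X ⟶ X + B`
along `ξ : B ♭ X ⟶ X`. -/
noncomputable def semidirect : C := pushout (flatIncl B X) ξ.map

/-- The quotient map `[j, i] : X + B ⟶ X ⋊ B`. -/
noncomputable def quot : X ⨿ B ⟶ ξ.semidirect := pushout.inl _ _

/-- The canonical morphism `j : X ⟶ X ⋊ B`. -/
noncomputable def j : X ⟶ ξ.semidirect := pushout.inr _ _

/-- The canonical morphism `i : B ⟶ X ⋊ B`. -/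
noncomputable def i : B ⟶ ξ.semidirect := coprod.inr ≫ ξ.quot

theorem quot_w : flatIncl B X ≫ ξ.quot = ξ.map ≫ ξ.j := pushout.condition

theorem inl_quot : coprod.inl ≫ ξ.quot = ξ.j := by
  rw [← flatUnit_incl B X, Category.assoc, quot_w, ← Category.assoc, ξ.unit, Category.id_comp]

theorem quot_eq : ξ.quot = coprod.desc ξ.j ξ.i := by
  ext
  · simp [inl_quot]
  · simp [i]

theorem j_w : ξ.map ≫ ξ.j = flatIncl B X ≫ coprod.desc ξ.j ξ.i := by
  rw [← quot_w, quot_eq]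

theorem hom_ext {Z : C} {f g : ξ.semidirect ⟶ Z} (hj : ξ.j ≫ f = ξ.j ≫ g)
    (hi : ξ.i ≫ f = ξ.i ≫ g) : f = g := by
  refine pushout.hom_ext ?_ hj
  change ξ.quot ≫ f = ξ.quot ≫ g
  ext
  · simp only [← Category.assoc, inl_quot, hj]
  · simpa [i] using hi

/-- The morphism `[x, b⟩ : X ⋊ B ⟶ Z`. -/
noncomputable def desc {Z : C} (x : X ⟶ Z) (b : B ⟶ Z)
    (h : ξ.map ≫ x = flatIncl B X ≫ coprod.desc x b) : ξ.semidirect ⟶ Z :=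
  pushout.desc (coprod.desc x b) x h.symm

section
variable {Z : C} (x : X ⟶ Z) (b : B ⟶ Z) (h : ξ.map ≫ x = flatIncl B X ≫ coprod.desc x b)

@[simp]
theorem j_desc : ξ.j ≫ ξ.desc x b h = x := pushout.inr_desc _ _ _

@[simp]
theorem i_desc : ξ.i ≫ ξ.desc x b h = b := by
  have : ξ.quot ≫ ξ.desc x b h = coprod.desc x b := pushout.inl_desc _ _ _
  rw [i, Category.assoc, this, coprod.inr_desc]

@[simp]
theorem j_desc_assoc {W : C} (w : Z ⟶ W) : ξ.j ≫ ξ.desc x b h ≫ w = x ≫ w := by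
  rw [← Category.assoc, j_desc]

@[simp]
theorem i_desc_assoc {W : C} (w : Z ⟶ W) : ξ.i ≫ ξ.desc x b h ≫ w = b ≫ w := by
  rw [← Category.assoc, i_desc]
end

/-- The canonical projection `p : X ⋊ B ⟶ B`. -/
noncomputable def p : ξ.semidirect ⟶ B :=
  ξ.desc 0 (𝟙 B) (by rw [comp_zero, flatIncl_desc_zero])

@[simp] theorem j_p : ξ.j ≫ ξ.p = 0 := ξ.j_desc _ _ _

@[simp] theorem i_p : ξ.i ≫ ξ.p = 𝟙 B := ξ.i_desc _ _ _

@[simp] theorem i_p_assoc {W : C} (w : B ⟶ W) : ξ.i ≫ ξ.p ≫ w = w := by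
  rw [← Category.assoc, i_p, Category.id_comp]

instance : IsRegularEpi ξ.quot := by
  have : Epi ξ.quot := ⟨fun f g h => ξ.hom_ext
    (by rw [← inl_quot, Category.assoc, h, Category.assoc])
    (by rw [i, Category.assoc, h, Category.assoc])⟩
  have : StrongEpi ξ.quot := by
    refine StrongEpi.mk' fun W V z hz a b sq => ?_
    have h : ξ.map ≫ coprod.inl ≫ a = flatIncl B X ≫ coprod.desc (coprod.inl ≫ a)
        (coprod.inr ≫ a) := by
      have : coprod.desc (coprod.inl ≫ a) (coprod.inr ≫ a) = a := by ext <;> simp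
      rw [this, ← cancel_mono z]
      simp only [Category.assoc, sq.w]
      rw [← Category.assoc coprod.inl, inl_quot, ← Category.assoc, ← quot_w, Category.assoc]
    have h' : ξ.quot ≫ ξ.desc _ _ h = a := by
      rw [quot_eq]
      ext <;> simp
    exact ⟨⟨⟨ξ.desc _ _ h, h', by
      rw [← cancel_epi ξ.quot, ← Category.assoc, h', sq.w]⟩⟩⟩
  infer_instance

/-- The canonical morphism `j` is a kernel of the projection `X ⋊ B ⟶ B`. -/
theorem j_isKernelOf : IsKernelOf ξ.j ξ.p := by
  let l : X ⟶ kernel ξ.p := kernel.lift _ ξ.j ξ.j_p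
  have hl : l ≫ kernel.ι ξ.p = ξ.j := kernel.lift_ι _ _ _
  have hqp : ξ.quot ≫ ξ.p = coprod.desc 0 (𝟙 B) := by rw [quot_eq]; ext <;> simp
  have hreg : IsRegularEpi (ξ.map ≫ l) :=
    Regular.regularEpiIsStableUnderBaseChange.of_isPullback
      (isPullback_of_kernels (flatIncl_isKernelOf B X) (isKernelOf_kernel ξ.p)
        (a := ξ.map ≫ l) (f := ξ.quot) (by rw [Category.assoc, hl, quot_w]) hqp).flip
      (inferInstanceAs (IsRegularEpi ξ.quot))
  have hst : StrongEpi l := strongEpi_of_strongEpi ξ.map l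
  have hmono : Mono l := by
    refine ⟨fun {Z} a b hab => ?_⟩
    obtain ⟨Q, q, w, -, hq⟩ := reflexive_coequalizer
      (coprod.desc (flatIncl B X) coprod.inr : flat B X ⨿ B ⟶ X ⨿ B) (coprod.map ξ.map (𝟙 B))
      (coprod.map (flatUnit B X) (𝟙 B)) (by ext <;> simp) (by ext <;> simp [ξ.unit])
    have hw : flatIncl B X ≫ q = ξ.map ≫ coprod.inl ≫ q := by
      simpa using congr(coprod.inl ≫ $w)
    let r : ξ.semidirect ⟶ Q := pushout.desc q (coprod.inl ≫ q) hw
    have hr : ξ.j ≫ r = coprod.inl ≫ q := pushout.inr_desc _ _ _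
    have hab' : (a ≫ coprod.inl) ≫ q = (b ≫ coprod.inl) ≫ q := by
      rw [Category.assoc, Category.assoc, ← hr, ← hl]
      simp only [Category.assoc, reassoc_of% hab]
    obtain ⟨Z', e, t, he, h₁, h₂⟩ := hq _ _ hab'
    have ht : t ≫ coprod.desc 0 (𝟙 B) = 0 := by
      have := congr($h₂ ≫ coprod.desc 0 (𝟙 B))
      simpa using this
    obtain ⟨t', rfl⟩ := (flatIncl_isKernelOf B (flat B X)).exists_lift t ht
    have h₁' : t' ≫ flatMul B X = e ≫ a ≫ flatUnit B X := by
      rw [← cancel_mono (flatIncl B X)]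
      simpa using h₁
    have h₂' : t' ≫ flatMap (𝟙 B) ξ.map = e ≫ b ≫ flatUnit B X := by
      rw [← cancel_mono (flatIncl B X)]
      simpa using h₂
    rw [← cancel_epi e]
    calc e ≫ a = (e ≫ a ≫ flatUnit B X) ≫ ξ.map := by simp [ξ.unit]
      _ = (e ≫ b ≫ flatUnit B X) ≫ ξ.map := by
        rw [← h₁', ← h₂', Category.assoc, Category.assoc, ξ.assoc]
      _ = e ≫ b := by simp [ξ.unit]
  have : IsIso l := isIso_of_mono_of_strongEpi l
  have : Mono ξ.j := by rw [← hl]; infer_instance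
  refine IsKernelOf.mk' ξ.j_p fun z hz => ⟨kernel.lift _ z hz ≫ inv l, ?_⟩
  rw [← hl]
  simp

instance : Mono ξ.j := ξ.j_isKernelOf.mono

/-- The morphism of semidirect products induced by an equivariant pair of morphisms. -/
noncomputable def semidirectMap {B' X' : C} (ξ : InternalAction B X) (ξ' : InternalAction B' X')
    (x : X ⟶ X') (b : B ⟶ B') (h : ξ.map ≫ x = flatMap b x ≫ ξ'.map) :
    ξ.semidirect ⟶ ξ'.semidirect :=
  ξ.desc (x ≫ ξ'.j) (b ≫ ξ'.i) (by
    rw [← Category.assoc, h, Category.assoc, j_w, flatMap_incl_assoc, coprod.map_desc])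

section
variable {B' X' : C} (ξ' : InternalAction B' X') (x : X ⟶ X') (b : B ⟶ B')
  (h : ξ.map ≫ x = flatMap b x ≫ ξ'.map)

@[simp] theorem j_semidirectMap : ξ.j ≫ ξ.semidirectMap ξ' x b h = x ≫ ξ'.j := ξ.j_desc _ _ _

@[simp] theorem i_semidirectMap : ξ.i ≫ ξ.semidirectMap ξ' x b h = b ≫ ξ'.i := ξ.i_desc _ _ _

@[simp] theorem j_semidirectMap_assoc {W : C} (w : ξ'.semidirect ⟶ W) :
    ξ.j ≫ ξ.semidirectMap ξ' x b h ≫ w = x ≫ ξ'.j ≫ w := by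
  rw [← Category.assoc, j_semidirectMap, Category.assoc]

@[simp] theorem i_semidirectMap_assoc {W : C} (w : ξ'.semidirect ⟶ W) :
    ξ.i ≫ ξ.semidirectMap ξ' x b h ≫ w = b ≫ ξ'.i ≫ w := by
  rw [← Category.assoc, i_semidirectMap, Category.assoc]

@[simp] theorem semidirectMap_p : ξ.semidirectMap ξ' x b h ≫ ξ'.p = ξ.p ≫ b := by
  apply ξ.hom_ext
  · rw [j_semidirectMap_assoc, ξ'.j_p, comp_zero, ← Category.assoc, ξ.j_p, zero_comp]
  · simp
end

/-- Comparison of the semidirect product with a point inducing the same action. -/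
theorem isIso_desc {E : C} {k : X ⟶ E} {d : E ⟶ B} {e : B ⟶ E} (he : e ≫ d = 𝟙 B)
    (hk : IsKernelOf k d) (h : ξ.map ≫ k = flatIncl B X ≫ coprod.desc k e) :
    IsIso (ξ.desc k e h) :=
  SemiAbelian.split_short_five ξ.j ξ.p ξ.i k d e (𝟙 X) (ξ.desc k e h) (𝟙 B) ξ.i_p he
    ξ.j_isKernelOf hk (by simp) (ξ.hom_ext (by simp [hk.w]) (by simp [he])) (by simp)
    inferInstance inferInstance

/-- The map `1 ⋊ g : X ⋊ Y ⟶ X ⋊ B` induced by `g : Y ⟶ B`. -/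
noncomputable def restrictMap {Y : C} (g : Y ⟶ B) : (ξ.restrict g).semidirect ⟶ ξ.semidirect :=
  semidirectMap _ _ (𝟙 X) g (by simp [restrict])

/-- The semidirect product of the restricted action is the pullback of the semidirect product. -/
theorem isPullback_restrict {Y : C} (g : Y ⟶ B) :
    IsPullback (ξ.restrict g).p (ξ.restrictMap g) g ξ.p := by
  have w : (ξ.restrict g).p ≫ g = ξ.restrictMap g ≫ ξ.p := (semidirectMap_p _ _ _ _ _).symm
  let k : X ⟶ pullback g ξ.p := pullback.lift 0 ξ.j (by simp)
  let e : Y ⟶ pullback g ξ.p := pullback.lift (𝟙 Y) (g ≫ ξ.i) (by simp)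
  have hk₂ : k ≫ pullback.snd g ξ.p = ξ.j := by simp [k]
  have hk : IsKernelOf k (pullback.fst g ξ.p) := by
    have : Mono k := by
      have : Mono (k ≫ pullback.snd g ξ.p) := by rw [hk₂]; infer_instance
      exact mono_of_mono k (pullback.snd g ξ.p)
    refine IsKernelOf.mk' (by simp [k]) fun z hz => ?_
    obtain ⟨t, ht⟩ := ξ.j_isKernelOf.exists_lift (z ≫ pullback.snd g ξ.p)
      (by rw [Category.assoc, ← pullback.condition, ← Category.assoc, hz, zero_comp])
    refine ⟨t, pullback.hom_ext ?_ ?_⟩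
    · simp [k, hz]
    · simp [k, ht]
  have h : (ξ.restrict g).map ≫ k = flatIncl Y X ≫ coprod.desc k e := by
    apply pullback.hom_ext
    · simp [k, e, flatIncl_desc_zero]
    · simp [k, e, restrict, j_w]
  have hiso := (ξ.restrict g).isIso_desc (by simp [e]) hk h
  have hd : (ξ.restrict g).desc k e h = pullback.lift _ _ w := by
    apply hom_ext
    · apply pullback.hom_ext
      · simp [k]
      · simp [k, restrictMap]
    · apply pullback.hom_ext
      · simp [e]
      · simp [e, restrictMap]
  rw [hd] at hiso
  exact IsPullback.of_iso_pullback ⟨w⟩ (asIso (pullback.lift _ _ w)) (by simp) (by simp)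

end InternalAction

end Flat

section PXMod

variable {C : Type u} [Category.{v} C] [HasZeroMorphisms C] [SemiAbelian C]

/-- An internal pre-crossed module over `B`: a morphism `δ : X ⟶ B` with an internal action of `B`
on `X` such that `δ` is equivariant for the conjugation action of `B` on itself. -/
structure PXMod (B : C) where
  obj : C
  bd : obj ⟶ B
  act : InternalAction B obj
  comm : act.map ≫ bd = flatMap (𝟙 B) bd ≫ conj B

namespace PXMod

variable {B : C}

/-- A morphism of pre-crossed modules over `B`: an equivariant morphism over `B`. -/
@[ext]
structure Hom (X Y : PXMod B) where
  hom : X.obj ⟶ Y.obj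
  bd : hom ≫ Y.bd = X.bd
  equivariant : X.act.map ≫ hom = flatMap (𝟙 B) hom ≫ Y.act.map

/-- The category of internal pre-crossed modules over `B`. -/
instance : Category (PXMod B) where
  Hom := Hom
  id X := ⟨𝟙 _, by simp, by simp⟩
  comp f g := ⟨f.hom ≫ g.hom, by rw [Category.assoc, g.bd, f.bd], by
    rw [← Category.assoc, f.equivariant, Category.assoc, g.equivariant, ← Category.assoc,
      flatMap_comp, Category.comp_id]⟩
  id_comp f := by cases f; simp
  comp_id f := by cases f; simp
  assoc f g h := by simp

@[simp] theorem id_hom (X : PXMod B) : Hom.hom (𝟙 X) = 𝟙 X.obj := rfl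

@[simp] theorem comp_hom {X Y Z : PXMod B} (f : X ⟶ Y) (g : Y ⟶ Z) :
    Hom.hom (f ≫ g) = Hom.hom f ≫ Hom.hom g := rfl

theorem hom_ext {X Y : PXMod B} {f g : X ⟶ Y} (h : Hom.hom f = Hom.hom g) : f = g := by
  exact Hom.ext h

theorem mono_of_mono_hom {X Y : PXMod B} (f : X ⟶ Y) [Mono (Hom.hom f)] : Mono f :=
  ⟨fun g h w => hom_ext (by
    rw [← cancel_mono (Hom.hom f)]
    exact congr(Hom.hom $w))⟩

/-- The codomain map `[δ, 1⟩ : X ⋊ B ⟶ B` of the reflexive graph associated with `X`. -/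
noncomputable def cod (X : PXMod B) : X.act.semidirect ⟶ B :=
  X.act.desc X.bd (𝟙 B) (by rw [X.comm, conj, flatMap_incl_assoc, coprod.map_desc]; simp)

@[simp] theorem j_cod (X : PXMod B) : X.act.j ≫ X.cod = X.bd := X.act.j_desc _ _ _

@[simp] theorem i_cod (X : PXMod B) : X.act.i ≫ X.cod = 𝟙 B := X.act.i_desc _ _ _

/-- The pre-crossed module obtained by normalizing a reflexive graph `(d, c, e)` over `B`: the
restriction of `c` to the kernel of `d`, with the conjugation action. -/
noncomputable def ofGraph {E : C} (d c : E ⟶ B) (e : B ⟶ E) (hd : e ≫ d = 𝟙 B)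
    (hc : e ≫ c = 𝟙 B) : PXMod B :=
  have w : (flatIncl B (kernel d) ≫ coprod.desc (kernel.ι d) e) ≫ d = 0 := by
    rw [Category.assoc, coprod.desc_comp, kernel.condition, hd, flatIncl_w]
  have hl := kernel.lift_ι d _ w
  { obj := kernel d
    bd := kernel.ι d ≫ c
    act :=
      { map := kernel.lift d (flatIncl B (kernel d) ≫ coprod.desc (kernel.ι d) e) w
        unit := by
          rw [← cancel_mono (kernel.ι d), Category.assoc, hl]
          simp
        assoc := by
          rw [← cancel_mono (kernel.ι d), Category.assoc, Category.assoc, hl, flatMap_incl_assoc,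
            flatMul_incl_assoc]
          congr 1
          ext
          · simp
          · simp }
    comm := by
      rw [← Category.assoc, hl, conj, flatMap_incl_assoc, Category.assoc]
      congr 1
      ext
      · simp
      · simp [hc] }

/-- The inclusion of a normalized graph in the graph. -/
noncomputable def graphIncl {E : C} (d c : E ⟶ B) (e : B ⟶ E) (hd : e ≫ d = 𝟙 B)
    (hc : e ≫ c = 𝟙 B) : (ofGraph d c e hd hc).obj ⟶ E := kernel.ι d

theorem graphIncl_isKernelOf {E : C} (d c : E ⟶ B) (e : B ⟶ E) (hd : e ≫ d = 𝟙 B)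
    (hc : e ≫ c = 𝟙 B) : IsKernelOf (graphIncl d c e hd hc) d := isKernelOf_kernel d

instance {E : C} (d c : E ⟶ B) (e : B ⟶ E) (hd : e ≫ d = 𝟙 B) (hc : e ≫ c = 𝟙 B) :
    Mono (graphIncl d c e hd hc) := (graphIncl_isKernelOf d c e hd hc).mono

theorem graphIncl_w {E : C} (d c : E ⟶ B) (e : B ⟶ E) (hd : e ≫ d = 𝟙 B) (hc : e ≫ c = 𝟙 B) :
    graphIncl d c e hd hc ≫ d = 0 := kernel.condition d

theorem graphIncl_cod {E : C} (d c : E ⟶ B) (e : B ⟶ E) (hd : e ≫ d = 𝟙 B) (hc : e ≫ c = 𝟙 B) :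
    graphIncl d c e hd hc ≫ c = (ofGraph d c e hd hc).bd := rfl

/-- The morphism to a normalized graph induced by a morphism to the graph. -/
noncomputable def graphLift {E : C} (d c : E ⟶ B) (e : B ⟶ E) (hd : e ≫ d = 𝟙 B)
    (hc : e ≫ c = 𝟙 B) {Z : C} (z : Z ⟶ E) (hz : z ≫ d = 0) : Z ⟶ (ofGraph d c e hd hc).obj :=
  kernel.lift d z hz

theorem graphLift_incl {E : C} (d c : E ⟶ B) (e : B ⟶ E) (hd : e ≫ d = 𝟙 B)
    (hc : e ≫ c = 𝟙 B) {Z : C} (z : Z ⟶ E) (hz : z ≫ d = 0) :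
    graphLift d c e hd hc z hz ≫ graphIncl d c e hd hc = z := kernel.lift_ι _ _ _

theorem ofGraph_act {E : C} (d c : E ⟶ B) (e : B ⟶ E) (hd : e ≫ d = 𝟙 B) (hc : e ≫ c = 𝟙 B) :
    (ofGraph d c e hd hc).act.map ≫ graphIncl d c e hd hc = flatIncl B _ ≫
      coprod.desc (graphIncl d c e hd hc) e := kernel.lift_ι _ _ _

/-- The functorial map `f ⋊ 1`. -/
noncomputable def sdMap {X Y : PXMod B} (f : X ⟶ Y) : X.act.semidirect ⟶ Y.act.semidirect :=
  X.act.semidirectMap Y.act (Hom.hom f) (𝟙 B) (Hom.equivariant f)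

@[simp] theorem j_sdMap {X Y : PXMod B} (f : X ⟶ Y) :
    X.act.j ≫ sdMap f = Hom.hom f ≫ Y.act.j := InternalAction.j_semidirectMap _ _ _ _ _

@[simp] theorem i_sdMap {X Y : PXMod B} (f : X ⟶ Y) : X.act.i ≫ sdMap f = Y.act.i := by
  simp [sdMap]

@[simp] theorem sdMap_p {X Y : PXMod B} (f : X ⟶ Y) : sdMap f ≫ Y.act.p = X.act.p := by
  simp [sdMap]

@[simp] theorem sdMap_cod {X Y : PXMod B} (f : X ⟶ Y) : sdMap f ≫ Y.cod = X.cod := by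
  apply X.act.hom_ext
  · rw [← Category.assoc, j_sdMap, Category.assoc, j_cod, j_cod, Hom.bd]
  · rw [← Category.assoc, i_sdMap, i_cod, i_cod]

theorem sdMap_comp {X Y Z : PXMod B} (f : X ⟶ Y) (g : Y ⟶ Z) :
    sdMap (f ≫ g) = sdMap f ≫ sdMap g := by
  apply X.act.hom_ext
  · rw [j_sdMap, ← Category.assoc, j_sdMap, Category.assoc, j_sdMap]; simp
  · rw [i_sdMap, ← Category.assoc, i_sdMap, i_sdMap]

section Normalization

variable {E : C} {d c : E ⟶ B} {e : B ⟶ E} {hd : e ≫ d = 𝟙 B} {hc : e ≫ c = 𝟙 B}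

/-- Morphisms into a normalized graph. -/
noncomputable def toGraph {X : PXMod B} (f : X.act.semidirect ⟶ E) (h₁ : f ≫ d = X.act.p)
    (h₂ : f ≫ c = X.cod) (h₃ : X.act.i ≫ f = e) : X ⟶ ofGraph d c e hd hc where
  hom := graphLift d c e hd hc (X.act.j ≫ f) (by rw [Category.assoc, h₁, X.act.j_p])
  bd := by
    rw [← graphIncl_cod, ← Category.assoc, graphLift_incl, Category.assoc, h₂, j_cod]
  equivariant := by
    have hz : (X.act.j ≫ f) ≫ d = 0 := by rw [Category.assoc, h₁, X.act.j_p]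
    have hi := graphLift_incl d c e hd hc _ hz
    rw [← cancel_mono (graphIncl d c e hd hc), Category.assoc, hi, Category.assoc, ofGraph_act,
      flatMap_incl_assoc, ← Category.assoc, X.act.j_w, Category.assoc, coprod.map_desc,
      coprod.desc_comp, h₃, hi, Category.id_comp]

theorem toGraph_hom {X : PXMod B} (f : X.act.semidirect ⟶ E) (h₁ : f ≫ d = X.act.p)
    (h₂ : f ≫ c = X.cod) (h₃ : X.act.i ≫ f = e) :
    Hom.hom (toGraph (hd := hd) (hc := hc) f h₁ h₂ h₃) ≫ graphIncl d c e hd hc = X.act.j ≫ f :=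
  graphLift_incl _ _ _ _ _ _ _

/-- The canonical morphism from the semidirect product of a normalized graph. -/
noncomputable def graphComp (d c : E ⟶ B) (e : B ⟶ E) (hd : e ≫ d = 𝟙 B) (hc : e ≫ c = 𝟙 B) :
    (ofGraph d c e hd hc).act.semidirect ⟶ E :=
  (ofGraph d c e hd hc).act.desc (graphIncl d c e hd hc) e (ofGraph_act d c e hd hc)

instance : IsIso (graphComp d c e hd hc) :=
  InternalAction.isIso_desc _ hd (graphIncl_isKernelOf d c e hd hc) _

theorem j_graphComp : (ofGraph d c e hd hc).act.j ≫ graphComp d c e hd hc = graphIncl d c e hd hc :=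
  InternalAction.j_desc _ _ _ _

theorem i_graphComp : (ofGraph d c e hd hc).act.i ≫ graphComp d c e hd hc = e :=
  InternalAction.i_desc _ _ _ _

theorem graphComp_p : graphComp d c e hd hc ≫ d = (ofGraph d c e hd hc).act.p := by
  apply InternalAction.hom_ext
  · rw [← Category.assoc, j_graphComp, graphIncl_w, InternalAction.j_p]
  · rw [← Category.assoc, i_graphComp, hd, InternalAction.i_p]

theorem graphComp_cod : graphComp d c e hd hc ≫ c = (ofGraph d c e hd hc).cod := by
  apply InternalAction.hom_ext
  · rw [← Category.assoc, j_graphComp, j_cod]; rfl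
  · rw [← Category.assoc, i_graphComp, hc, i_cod]

theorem sdMap_toGraph {X : PXMod B} (f : X.act.semidirect ⟶ E) (h₁ : f ≫ d = X.act.p)
    (h₂ : f ≫ c = X.cod) (h₃ : X.act.i ≫ f = e) :
    sdMap (toGraph (hd := hd) (hc := hc) f h₁ h₂ h₃) ≫ graphComp d c e hd hc = f := by
  apply InternalAction.hom_ext
  · rw [← Category.assoc, j_sdMap, Category.assoc, j_graphComp, toGraph_hom]
  · rw [← Category.assoc, i_sdMap, i_graphComp, h₃]

end Normalization

/-- A morphism of the associated reflexive graphs induces a morphism of pre-crossed modules. -/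
theorem exists_sdMap {X Y : PXMod B} (f : X.act.semidirect ⟶ Y.act.semidirect)
    (h₁ : f ≫ Y.act.p = X.act.p) (h₂ : f ≫ Y.cod = X.cod) (h₃ : X.act.i ≫ f = Y.act.i) :
    ∃ g : X ⟶ Y, sdMap g = f := by
  obtain ⟨t, ht⟩ := Y.act.j_isKernelOf.exists_lift (X.act.j ≫ f)
    (by rw [Category.assoc, h₁, X.act.j_p])
  refine ⟨⟨t, ?_, ?_⟩, X.act.hom_ext ?_ ?_⟩
  · rw [← j_cod, ← Category.assoc, ht, Category.assoc, h₂, j_cod]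
  · rw [← cancel_mono Y.act.j, Category.assoc, ht, ← Category.assoc, X.act.j_w, Category.assoc,
      Category.assoc, Y.act.j_w, flatMap_incl_assoc, coprod.map_desc, coprod.desc_comp, h₃, ht,
      Category.id_comp]
  · rw [j_sdMap]; exact ht
  · rw [i_sdMap, h₃]

theorem sdMap_injective {X Y : PXMod B} {f g : X ⟶ Y} (h : sdMap f = sdMap g) : f = g := by
  apply hom_ext
  rw [← cancel_mono Y.act.j, ← j_sdMap, ← j_sdMap, h]

theorem hasColimit_span {S X Y : PXMod B} (f : S ⟶ X) (g : S ⟶ Y) : HasColimit (span f g) := by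
  let E := pushout (sdMap f) (sdMap g)
  let a : X.act.semidirect ⟶ E := pushout.inl _ _
  let b : Y.act.semidirect ⟶ E := pushout.inr _ _
  have hab : sdMap f ≫ a = sdMap g ≫ b := pushout.condition
  let d : E ⟶ B := pushout.desc X.act.p Y.act.p (by rw [sdMap_p, sdMap_p])
  let c : E ⟶ B := pushout.desc X.cod Y.cod (by rw [sdMap_cod, sdMap_cod])
  have had : a ≫ d = X.act.p := pushout.inl_desc _ _ _
  have hbd : b ≫ d = Y.act.p := pushout.inr_desc _ _ _
  have hac : a ≫ c = X.cod := pushout.inl_desc _ _ _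
  have hbc : b ≫ c = Y.cod := pushout.inr_desc _ _ _
  let e : B ⟶ E := X.act.i ≫ a
  have he : Y.act.i ≫ b = e := by
    rw [← i_sdMap g, Category.assoc, ← hab, ← Category.assoc, i_sdMap]
  have hd : e ≫ d = 𝟙 B := by rw [Category.assoc, had, X.act.i_p]
  have hc : e ≫ c = 𝟙 B := by rw [Category.assoc, hac, i_cod]
  let K := ofGraph d c e hd hc
  let u : X ⟶ K := toGraph a had hac rfl
  let v : Y ⟶ K := toGraph b hbd hbc he
  have hu : sdMap u ≫ graphComp d c e hd hc = a := sdMap_toGraph _ _ _ _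
  have hv : sdMap v ≫ graphComp d c e hd hc = b := sdMap_toGraph _ _ _ _
  have hw : f ≫ u = g ≫ v := by
    apply sdMap_injective
    rw [← cancel_mono (graphComp d c e hd hc), sdMap_comp, sdMap_comp, Category.assoc,
      Category.assoc, hu, hv, hab]
  refine ⟨⟨⟨PushoutCocone.mk u v hw, PushoutCocone.isColimitAux' _ fun s => ?_⟩⟩⟩
  have hs : sdMap f ≫ sdMap s.inl = sdMap g ≫ sdMap s.inr := by
    rw [← sdMap_comp, ← sdMap_comp, s.condition]
  let D : E ⟶ s.pt.act.semidirect := pushout.desc (sdMap s.inl) (sdMap s.inr) hs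
  have haD : a ≫ D = sdMap s.inl := pushout.inl_desc _ _ _
  have hbD : b ≫ D = sdMap s.inr := pushout.inr_desc _ _ _
  have hDp : D ≫ s.pt.act.p = d := by
    apply pushout.hom_ext
    · change a ≫ D ≫ _ = a ≫ d
      rw [← Category.assoc, haD, sdMap_p, had]
    · change b ≫ D ≫ _ = b ≫ d
      rw [← Category.assoc, hbD, sdMap_p, hbd]
  have hDc : D ≫ s.pt.cod = c := by
    apply pushout.hom_ext
    · change a ≫ D ≫ _ = a ≫ c
      rw [← Category.assoc, haD, sdMap_cod, hac]
    · change b ≫ D ≫ _ = b ≫ c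
      rw [← Category.assoc, hbD, sdMap_cod, hbc]
  have hDe : e ≫ D = s.pt.act.i := by rw [Category.assoc, haD, i_sdMap]
  have ht := exists_sdMap (graphComp d c e hd hc ≫ D)
    (by rw [Category.assoc, hDp, graphComp_p]) (by rw [Category.assoc, hDc, graphComp_cod])
    (by rw [← Category.assoc, i_graphComp, hDe])
  have huniq : ∀ m : K ⟶ s.pt, u ≫ m = s.inl → v ≫ m = s.inr → m = ht.choose := by
    intro m h₁ h₂
    apply sdMap_injective
    rw [ht.choose_spec]
    rw [← cancel_epi (inv (graphComp d c e hd hc)), IsIso.inv_hom_id_assoc]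
    apply pushout.hom_ext
    · change a ≫ _ = a ≫ D
      rw [haD, ← h₁, sdMap_comp]
      simp only [← hu, Category.assoc, IsIso.hom_inv_id_assoc]
    · change b ≫ _ = b ≫ D
      rw [hbD, ← h₂, sdMap_comp]
      simp only [← hv, Category.assoc, IsIso.hom_inv_id_assoc]
  refine ⟨ht.choose, sdMap_injective ?_, sdMap_injective ?_, fun {m} h₁ h₂ => ?_⟩
  · exact (sdMap_comp u ht.choose).trans (by
      rw [ht.choose_spec, ← Category.assoc, hu, haD])
  · exact (sdMap_comp v ht.choose).trans (by
      rw [ht.choose_spec, ← Category.assoc, hv, hbD])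
  · exact huniq m h₁ h₂

instance : HasPushouts (PXMod B) :=
  have : ∀ {S X Y : PXMod B} {f : S ⟶ X} {g : S ⟶ Y}, HasColimit (span f g) :=
    hasColimit_span _ _
  hasPushouts_of_hasColimit_span _

theorem flat_eq_zero {X Z : C} (hX : IsZero X) (f : flat B X ⟶ Z) : f = 0 := by
  rw [← Category.id_comp f, ← flatMap_id, hX.eq_of_src (𝟙 X) 0, flatMap_zero, zero_comp]

/-- The initial pre-crossed module `0 ⟶ B`. -/
noncomputable def zeroObj (B : C) : PXMod B :=
  have hz : IsZero (HasZeroObject.zero' C).zero := isZero_zero C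
  { obj := (HasZeroObject.zero' C).zero
    bd := 0
    act :=
      { map := 0
        unit := hz.eq_of_src _ _
        assoc := hz.eq_of_tgt _ _ }
    comm := by rw [comp_zero]; exact (flat_eq_zero hz _).symm }

theorem isZero_zeroObj (B : C) : IsZero (zeroObj B).obj := isZero_zero C

/-- `0 ⟶ B` is initial. -/
noncomputable def zeroObjIsInitial (B : C) : IsInitial (zeroObj B) :=
  IsInitial.ofUniqueHom (fun _ => ⟨0, (isZero_zeroObj B).eq_of_src _ _,
      (flat_eq_zero (isZero_zeroObj B) _).trans (flat_eq_zero (isZero_zeroObj B) _).symm⟩)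
    fun _ _ => hom_ext ((isZero_zeroObj B).eq_of_src _ _)

instance : HasInitial (PXMod B) := (zeroObjIsInitial B).hasInitial

instance : HasBinaryCoproducts (PXMod B) := hasBinaryCoproducts_of_hasInitial_and_pushouts _

/-- The pre-crossed module structure on a subobject that is stable under the action. -/
def ofMono (Y : PXMod B) {I : C} (m : I ⟶ Y.obj) [Mono m] (a : flat B I ⟶ I)
    (h : a ≫ m = flatMap (𝟙 B) m ≫ Y.act.map) : PXMod B where
  obj := I
  bd := m ≫ Y.bd
  act :=
    { map := a
      unit := by
        rw [← cancel_mono m, Category.assoc, h, ← Category.assoc, flatUnit_naturality,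
          Category.assoc, Y.act.unit, Category.comp_id, Category.id_comp]
      assoc := by
        rw [← cancel_mono m, Category.assoc, Category.assoc, h, flatMap_comp_assoc, h,
          ← Category.assoc (flatMul B I), flatMul_naturality, Category.assoc, ← Y.act.assoc,
          flatMap_comp_assoc] }
  comm := by
    rw [← Category.assoc, h, Category.assoc, Y.comm, flatMap_comp_assoc, Category.comp_id]

/-- The inclusion of a stable subobject. -/
def ofMonoι (Y : PXMod B) {I : C} (m : I ⟶ Y.obj) [Mono m] (a : flat B I ⟶ I)
    (h : a ≫ m = flatMap (𝟙 B) m ≫ Y.act.map) : ofMono Y m a h ⟶ Y where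
  hom := m
  bd := rfl
  equivariant := h

instance (Y : PXMod B) {I : C} (m : I ⟶ Y.obj) [Mono m] (a : flat B I ⟶ I)
    (h : a ≫ m = flatMap (𝟙 B) m ≫ Y.act.map) : Mono (ofMonoι Y m a h) :=
  have : Mono (Hom.hom (ofMonoι Y m a h)) := inferInstanceAs (Mono m)
  mono_of_mono_hom _

section Kernel

variable {X Y : PXMod B} (f : X ⟶ Y)

theorem kerAct_w : (flatMap (𝟙 B) (kernel.ι (Hom.hom f)) ≫ X.act.map) ≫ Hom.hom f = 0 := by
  rw [Category.assoc, Hom.equivariant f, flatMap_comp_assoc, kernel.condition, flatMap_zero,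
    zero_comp]

/-- The kernel of a morphism of pre-crossed modules: its kernel in `C`, with the restricted action
(and the zero morphism to `B`). -/
noncomputable def ker : PXMod B :=
  ofMono X (kernel.ι (Hom.hom f)) (kernel.lift _ _ (kerAct_w f)) (kernel.lift_ι _ _ _)

/-- The inclusion of the kernel. -/
noncomputable def kerι : ker f ⟶ X := ofMonoι _ _ _ _

instance : Mono (kerι f) := inferInstanceAs (Mono (ofMonoι _ _ _ _))

theorem ker_bd : (ker f).bd = 0 := by
  change kernel.ι (Hom.hom f) ≫ X.bd = 0
  rw [← Hom.bd f, ← Category.assoc, kernel.condition, zero_comp]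

theorem mono_hom [Mono f] : Mono (Hom.hom f) := by
  let z : ker f ⟶ X :=
    { hom := 0
      bd := by rw [zero_comp, ker_bd]
      equivariant := by rw [comp_zero, flatMap_zero, zero_comp] }
  have h : kerι f ≫ f = z ≫ f := hom_ext (by
    change kernel.ι (Hom.hom f) ≫ Hom.hom f = 0 ≫ Hom.hom f
    rw [kernel.condition, zero_comp])
  have h0 : kernel.ι (Hom.hom f) = 0 := congr(Hom.hom $((cancel_mono f).1 h))
  refine mono_of_isZero_kernel _ fun z hz => ?_
  rw [← kernel.lift_ι _ z hz, h0, comp_zero]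

end Kernel

/-- Images of pre-crossed modules are computed in `C`. -/
instance : HasImages (PXMod B) where
  has_image {X Y} f := by
    obtain ⟨I, m, e, hem, hm, he⟩ : ∃ (I : C) (m : I ⟶ Y.obj) (e : X.obj ⟶ I),
        e ≫ m = Hom.hom f ∧ Mono m ∧ IsRegularEpi e :=
      let F := Regular.strongEpiMonoFactorisation (Hom.hom f)
      ⟨F.I, F.m, F.e, F.fac, inferInstance, inferInstanceAs
        (IsRegularEpi (Regular.strongEpiMonoFactorisation (Hom.hom f)).e)⟩
    have hr : IsRegularEpi (flatMap (𝟙 B) e) := isRegularEpi_flatMap e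
    have sq : CommSq (X.act.map ≫ e) (flatMap (𝟙 B) e) m (flatMap (𝟙 B) m ≫ Y.act.map) := ⟨by
      rw [Category.assoc, hem, Hom.equivariant f, flatMap_comp_assoc, hem, Category.comp_id]⟩
    let e' : X ⟶ ofMono Y m sq.lift sq.fac_right :=
      { hom := e
        bd := by
          change e ≫ m ≫ Y.bd = _
          rw [← Category.assoc, hem, Hom.bd f]
        equivariant := sq.fac_left.symm }
    let F : MonoFactorisation f :=
      { I := ofMono Y m sq.lift sq.fac_right
        m := ofMonoι Y m sq.lift sq.fac_right
        m_mono := inferInstance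
        e := e'
        fac := hom_ext hem }
    have hl : ∀ F' : MonoFactorisation f, ∃ l : F.I ⟶ F'.I, l ≫ F'.m = F.m := by
      intro F'
      have := F'.m_mono
      have := mono_hom F'.m
      have sq' : CommSq (Hom.hom F'.e) e (Hom.hom F'.m) m := ⟨by
        rw [hem, ← comp_hom, F'.fac]⟩
      have hlm : sq'.lift ≫ Hom.hom F'.m = m := sq'.fac_right
      have h₁ : sq'.lift ≫ F'.I.bd = m ≫ Y.bd := by
        rw [← Hom.bd F'.m, ← Category.assoc, hlm]
      have h₂ : sq.lift ≫ sq'.lift = flatMap (𝟙 B) sq'.lift ≫ F'.I.act.map := by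
        rw [← cancel_mono (Hom.hom F'.m), Category.assoc, Category.assoc, Hom.equivariant F'.m,
          flatMap_comp_assoc, Category.comp_id, hlm]
        exact sq.fac_right
      exact ⟨⟨sq'.lift, h₁, h₂⟩, hom_ext hlm⟩
    exact ⟨⟨⟨F, ⟨fun F' => (hl F').choose, fun F' => (hl F').choose_spec⟩⟩⟩⟩

section SemidirectProduct

variable (X Y : PXMod B)

theorem sdProd_w : (X.act.restrict Y.bd).map ≫ X.bd =
    flatIncl Y.obj X.obj ≫ coprod.desc X.bd Y.bd := by
  change (flatMap Y.bd (𝟙 X.obj) ≫ X.act.map) ≫ X.bd = _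
  rw [Category.assoc, X.comm, flatMap_comp_assoc, conj, flatMap_incl_assoc, coprod.map_desc]
  simp

/-- The morphism `[δ_X, δ_Y⟩ : X ⋊ Y ⟶ B`. -/
noncomputable def sdProdBd : (X.act.restrict Y.bd).semidirect ⟶ B :=
  (X.act.restrict Y.bd).desc X.bd Y.bd (sdProd_w X Y)

theorem restrictMap_cod : X.act.restrictMap Y.bd ≫ X.cod = sdProdBd X Y := by
  apply InternalAction.hom_ext
  · simp [InternalAction.restrictMap, sdProdBd]
  · simp [InternalAction.restrictMap, sdProdBd]

theorem sdProdAct_w :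
    (flatMap (𝟙 B) (X.act.restrict Y.bd).p ≫ Y.act.map) ≫ Y.bd =
      (flatMap X.act.i (X.act.restrictMap Y.bd) ≫ conj X.act.semidirect) ≫ X.act.p := by
  rw [Category.assoc, Y.comm, flatMap_comp_assoc, Category.assoc, conj_naturality,
    flatMap_comp_assoc, X.act.i_p, (X.act.isPullback_restrict Y.bd).w, Category.comp_id]

/-- The action of `B` on `X ⋊ Y`, the pullback of `X ⋊ B ⟶ B` along `δ_Y : Y ⟶ B`: it is the given
action in the component `Y`, and conjugation by `i : B ⟶ X ⋊ B` in the component `X ⋊ B`. -/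
noncomputable def sdProdActMap :
    flat B (X.act.restrict Y.bd).semidirect ⟶ (X.act.restrict Y.bd).semidirect :=
  (X.act.isPullback_restrict Y.bd).lift _ _ (sdProdAct_w X Y)

theorem sdProdActMap_p : sdProdActMap X Y ≫ (X.act.restrict Y.bd).p =
    flatMap (𝟙 B) (X.act.restrict Y.bd).p ≫ Y.act.map := IsPullback.lift_fst _ _ _ _

theorem sdProdActMap_restrictMap : sdProdActMap X Y ≫ X.act.restrictMap Y.bd =
    flatMap X.act.i (X.act.restrictMap Y.bd) ≫ conj X.act.semidirect := IsPullback.lift_snd _ _ _ _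

/-- The semidirect product `X ⋊ Y` of pre-crossed modules over `B`, where `Y` acts on `X` by the
pullback `δ_Y^* ξ_X` of the action of `B`. -/
noncomputable def sdProd : PXMod B where
  obj := (X.act.restrict Y.bd).semidirect
  bd := sdProdBd X Y
  act :=
    { map := sdProdActMap X Y
      unit := by
        apply (X.act.isPullback_restrict Y.bd).hom_ext
        · rw [Category.assoc, sdProdActMap_p, ← Category.assoc, flatUnit_naturality,
            Category.assoc, Y.act.unit, Category.comp_id, Category.id_comp]
        · rw [Category.assoc, sdProdActMap_restrictMap, ← Category.assoc, flatUnit_naturality,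
            Category.assoc, conj_unit, Category.comp_id, Category.id_comp]
      assoc := by
        apply (X.act.isPullback_restrict Y.bd).hom_ext
        · rw [Category.assoc, Category.assoc, sdProdActMap_p, flatMap_comp_assoc, sdProdActMap_p,
            ← Category.assoc (flatMul _ _), flatMul_naturality, Category.assoc, ← Y.act.assoc,
            flatMap_comp_assoc]
        · rw [Category.assoc, Category.assoc, sdProdActMap_restrictMap, flatMap_comp_assoc,
            sdProdActMap_restrictMap, ← Category.assoc (flatMul _ _), flatMul_naturality,
            Category.assoc, ← conj_assoc, flatMap_comp_assoc, Category.comp_id, Category.id_comp] }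
  comm := by
    rw [← restrictMap_cod, ← Category.assoc, sdProdActMap_restrictMap, Category.assoc,
      conj_naturality, flatMap_comp_assoc, i_cod]

theorem sdInl_equivariant : X.act.map ≫ (X.act.restrict Y.bd).j =
    flatMap (𝟙 B) (X.act.restrict Y.bd).j ≫ sdProdActMap X Y := by
  apply (X.act.isPullback_restrict Y.bd).hom_ext
  · rw [Category.assoc, InternalAction.j_p, comp_zero, Category.assoc, sdProdActMap_p,
      flatMap_comp_assoc, InternalAction.j_p, flatMap_zero, zero_comp]
  · have h : (X.act.restrict Y.bd).j ≫ X.act.restrictMap Y.bd = X.act.j := by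
      simp [InternalAction.restrictMap]
    rw [Category.assoc, h, Category.assoc, sdProdActMap_restrictMap, flatMap_comp_assoc, h,
      Category.id_comp, conj, flatMap_incl_assoc, coprod.map_desc, X.act.j_w, Category.comp_id,
      Category.comp_id]

/-- The morphism `j_X : X ⟶ X ⋊ Y` of pre-crossed modules. -/
noncomputable def sdInl : X ⟶ sdProd X Y where
  hom := (X.act.restrict Y.bd).j
  bd := InternalAction.j_desc _ _ _ (sdProd_w X Y)
  equivariant := sdInl_equivariant X Y

theorem sdInr_equivariant : Y.act.map ≫ (X.act.restrict Y.bd).i =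
    flatMap (𝟙 B) (X.act.restrict Y.bd).i ≫ sdProdActMap X Y := by
  apply (X.act.isPullback_restrict Y.bd).hom_ext
  · rw [Category.assoc, InternalAction.i_p, Category.comp_id, Category.assoc, sdProdActMap_p,
      flatMap_comp_assoc, InternalAction.i_p, Category.comp_id, flatMap_id, Category.id_comp]
  · have h : (X.act.restrict Y.bd).i ≫ X.act.restrictMap Y.bd = Y.bd ≫ X.act.i := by
      simp [InternalAction.restrictMap]
    rw [Category.assoc, h, Category.assoc, sdProdActMap_restrictMap, flatMap_comp_assoc, h,
      Category.id_comp, ← Category.assoc, Y.comm, Category.assoc, conj_naturality,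
      flatMap_comp_assoc, Category.id_comp]

/-- The morphism `i_Y : Y ⟶ X ⋊ Y` of pre-crossed modules. -/
noncomputable def sdInr : Y ⟶ sdProd X Y where
  hom := (X.act.restrict Y.bd).i
  bd := InternalAction.i_desc _ _ _ (sdProd_w X Y)
  equivariant := sdInr_equivariant X Y

end SemidirectProduct

section Peiffer

/-- The morphism `[j_X, i_Y] : X ⊕ Y ⟶ X ⋊ Y` from the coproduct of pre-crossed modules. -/
noncomputable def toSdLeft (X Y : PXMod B) : X ⨿ Y ⟶ sdProd X Y :=
  coprod.desc (sdInl X Y) (sdInr X Y)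

/-- The morphism `[i_X, j_Y] : X ⊕ Y ⟶ Y ⋊ X` from the coproduct of pre-crossed modules. -/
noncomputable def toSdRight (X Y : PXMod B) : X ⨿ Y ⟶ sdProd Y X :=
  coprod.desc (sdInr Y X) (sdInl Y X)

/-- The join, among the pre-crossed submodules of the coproduct `X ⊕ Y`, of the kernels of
`X ⊕ Y ⟶ X ⋊ Y` and `X ⊕ Y ⟶ Y ⋊ X`. -/
noncomputable def peifferKernel (X Y : PXMod B) : Subobject (X ⨿ Y) :=
  Subobject.mk (kerι (toSdLeft X Y)) ⊔ Subobject.mk (kerι (toSdRight X Y))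

/-- The Peiffer product `X ⋈ Y`: the pushout, in pre-crossed modules over `B`, of
`X ⊕ Y ⟶ X ⋊ Y` and `X ⊕ Y ⟶ Y ⋊ X`. -/
noncomputable def peifferProduct (X Y : PXMod B) : PXMod B :=
  pushout (toSdLeft X Y) (toSdRight X Y)

/-- The quotient morphism `X ⊕ Y ⟶ X ⋈ Y`, the diagonal of the pushout square. -/
noncomputable def peifferQuot (X Y : PXMod B) : X ⨿ Y ⟶ peifferProduct X Y :=
  toSdLeft X Y ≫ pushout.inl (toSdLeft X Y) (toSdRight X Y)

/-- The canonical morphism `l_X : X ⟶ X ⋈ Y`. -/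
noncomputable def peifferInl (X Y : PXMod B) : X ⟶ peifferProduct X Y :=
  coprod.inl ≫ peifferQuot X Y

/-- The canonical morphism `l_Y : Y ⟶ X ⋈ Y`. -/
noncomputable def peifferInr (X Y : PXMod B) : Y ⟶ peifferProduct X Y :=
  coprod.inr ≫ peifferQuot X Y

/-- The Peiffer commutator `⟨X, Y⟩` of two pre-crossed submodules `m : X ⟶ A`, `n : Y ⟶ A`: the
image of `peifferKernel X Y` under `[m, n] : X ⊕ Y ⟶ A`, a pre-crossed submodule of `A`. -/
noncomputable def peifferCommutator {X Y A : PXMod B} (m : X ⟶ A) (n : Y ⟶ A) : Subobject A :=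
  imageSubobject ((peifferKernel X Y).arrow ≫ coprod.desc m n)

end Peiffer

end PXMod

end PXMod
end Main
end Peiffer

/-!
Write `q : X ⊕ Y ⟶ X ⋈ Y` for the diagonal of the pushout of `[j_X, i_Y] : X ⊕ Y ⟶ X ⋊ Y` and
`[i_X, j_Y] : X ⊕ Y ⟶ Y ⋊ X`. A morphism `φ` as in the second condition is a factorization of
`[m, n]` through `q`, and it is unique because `q` is an epimorphism. By the universal property of
the pushout, such a factorization exists if and only if `[m, n]` factors through both legs
(`exists_peifferQuot_comp_eq_iff_factors`).

In `C` the underlying morphism of each leg is a regular epimorphism, since the quotient map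
`X + Y ⟶ X ⋊ Y` factors through it (`isRegularEpi_toSdLeft_hom`). In a semi-abelian category a
regular epimorphism is a cokernel of its kernel (`exists_desc_of_kernel_comp_eq_zero`), and this
property lifts to pre-crossed modules because `B ♭ (-)` preserves regular epimorphisms
(`exists_desc_of_kerι_comp`). Hence `[m, n]` factors through `q` if and only if it kills the kernels
of both legs. It kills them if and only if it kills their join (`sup_arrow_comp_hom_eq_zero`), that
is, if and only if the image of the join is zero (`isZero_imageSubobject_iff`).
-/

namespace Peiffer

section Cokernel

variable {C : Type u} [Category.{v} C] [HasZeroMorphisms C] [SemiAbelian C]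

/-- In a point, the kernel and the section are jointly epimorphic: their equalizer is a subobject
containing both. -/
theorem point_hom_ext {K A B Z : C} {k : K ⟶ A} {p : A ⟶ B} {s : B ⟶ A} (hs : s ≫ p = 𝟙 B)
    (hk : IsKernelOf k p) {f g : A ⟶ Z} (h₁ : k ≫ f = k ≫ g) (h₂ : s ≫ f = s ≫ g) : f = g := by
  have : IsIso (equalizer.ι f g) :=
    point_isIso hs hk (equalizer.ι f g) (equalizer.lift k h₁) (equalizer.lift s h₂)
      (equalizer.lift_ι _ _) (equalizer.lift_ι _ _)
  exact (cancel_epi (equalizer.ι f g)).1 (equalizer.condition f g)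

/-- A regular epimorphism is a cokernel of its kernel. -/
theorem exists_desc_of_kernel_comp_eq_zero {A A' Z : C} (f : A ⟶ A') [IsRegularEpi f] (g : A ⟶ Z)
    (h : kernel.ι f ≫ g = 0) : ∃ t : A' ⟶ Z, f ≫ t = g := by
  -- The kernel pair of `f` is a point over `A`, split by the diagonal, whose kernel is that of `f`.
  have hpair : pullback.fst f f ≫ g = pullback.snd f f ≫ g := by
    have hk := isKernelOf_kernel (pullback.fst f f)
    refine point_hom_ext (s := pullback.lift (𝟙 A) (𝟙 A) rfl) (pullback.lift_fst _ _ _) hk ?_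
      (by rw [← Category.assoc, ← Category.assoc, pullback.lift_fst, pullback.lift_snd])
    rw [← Category.assoc, hk.w, zero_comp, ← Category.assoc,
      ← kernel.lift_ι f (kernel.ι (pullback.fst f f) ≫ pullback.snd f f)
        (by rw [Category.assoc, ← pullback.condition, ← Category.assoc, hk.w, zero_comp]),
      Category.assoc, h, comp_zero]
  have hg : IsRegularEpi.left f ≫ g = IsRegularEpi.right f ≫ g := by
    rw [← pullback.lift_fst _ _ (IsRegularEpi.w f), Category.assoc, hpair, ← Category.assoc,
      pullback.lift_snd]
  exact ⟨IsRegularEpi.desc f g hg, IsRegularEpi.fac f g hg⟩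

end Cokernel

namespace PXMod

variable {C : Type u} [Category.{v} C] [HasZeroMorphisms C] [SemiAbelian C] {B : C}

theorem kerι_comp_hom {X Y : PXMod B} (f : X ⟶ Y) : Hom.hom (kerι f) ≫ Hom.hom f = 0 :=
  kernel.condition (Hom.hom f)

/-- A morphism killed by `f` in `C` factors through the kernel of `f` as a morphism of
pre-crossed modules. -/
theorem exists_lift_kerι {W X Y : PXMod B} (f : X ⟶ Y) (w : W ⟶ X)
    (h : Hom.hom w ≫ Hom.hom f = 0) : ∃ t : W ⟶ ker f, t ≫ kerι f = w := by
  obtain ⟨t, ht⟩ : ∃ t : W.obj ⟶ (ker f).obj, t ≫ Hom.hom (kerι f) = Hom.hom w :=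
    ⟨kernel.lift _ _ h, kernel.lift_ι _ _ _⟩
  have hm := mono_hom (kerι f)
  refine ⟨⟨t, ?_, ?_⟩, hom_ext ht⟩
  · rw [← Hom.bd (kerι f), ← Category.assoc, ht, Hom.bd]
  · rw [← cancel_mono (Hom.hom (kerι f)), Category.assoc, ht, Category.assoc,
      Hom.equivariant (kerι f), flatMap_comp_assoc, ht, Hom.equivariant, Category.comp_id]

/-- A morphism that kills two subobjects kills their join, since its kernel contains both. -/
theorem sup_arrow_comp_hom_eq_zero {S T X Y : PXMod B} (s : S ⟶ X) (t : T ⟶ X) [Mono s] [Mono t]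
    (f : X ⟶ Y) (hs : Hom.hom s ≫ Hom.hom f = 0) (ht : Hom.hom t ≫ Hom.hom f = 0) :
    Hom.hom ((Subobject.mk s ⊔ Subobject.mk t).arrow ≫ f) = 0 := by
  obtain ⟨a, ha⟩ := exists_lift_kerι f s hs
  obtain ⟨b, hb⟩ := exists_lift_kerι f t ht
  have hle : Subobject.mk s ⊔ Subobject.mk t ≤ Subobject.mk (kerι f) :=
    sup_le (Subobject.mk_le_mk_of_comm a ha) (Subobject.mk_le_mk_of_comm b hb)
  rw [← Subobject.ofLEMk_comp hle, Category.assoc, comp_hom, comp_hom, kerι_comp_hom, comp_zero]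

/-- The image of a morphism of pre-crossed modules vanishes exactly when the underlying morphism
in `C` does. -/
theorem isZero_imageSubobject_iff {X Y : PXMod B} (f : X ⟶ Y) :
    IsZero (imageSubobject f : PXMod B).obj ↔ Hom.hom f = 0 := by
  constructor
  · intro h
    rw [← imageSubobject_arrow_comp f, comp_hom, h.eq_of_tgt (Hom.hom _) 0, zero_comp]
  · intro h
    have hz := isZero_zeroObj B
    let z : zeroObj B ⟶ Y := (zeroObjIsInitial B).to Y
    have : Mono (Hom.hom z) := ⟨fun _ _ _ => hz.eq_of_tgt _ _⟩
    have : Mono z := mono_of_mono_hom z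
    -- A morphism to `0 ⟶ B` can only come from an object whose boundary is zero.
    have hX : X.bd = 0 := by rw [← Hom.bd f, h, zero_comp]
    let e : X ⟶ zeroObj B :=
      { hom := 0
        bd := by rw [zero_comp, hX]
        equivariant := hz.eq_of_tgt _ _ }
    have he : e ≫ z = f := hom_ext (by
      rw [comp_hom, h]
      exact zero_comp)
    have hle : imageSubobject f ≤ Subobject.mk z := imageSubobject_le_mk z f e he
    have hm := mono_hom (Subobject.ofLEMk _ _ hle)
    exact (IsZero.iff_id_eq_zero _).2
      ((cancel_mono (Hom.hom (Subobject.ofLEMk _ _ hle))).1 (hz.eq_of_tgt _ _))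

/-- A morphism of pre-crossed modules with regular epimorphic underlying morphism is a cokernel of
its kernel: the factorization in `C` is equivariant because `B ♭ (-)` preserves regular
epimorphisms. -/
theorem exists_desc_of_kerι_comp {X Y Z : PXMod B} (f : X ⟶ Y) [IsRegularEpi (Hom.hom f)]
    (g : X ⟶ Z) (h : Hom.hom (kerι f) ≫ Hom.hom g = 0) : ∃ t : Y ⟶ Z, f ≫ t = g := by
  obtain ⟨t, ht⟩ := exists_desc_of_kernel_comp_eq_zero (Hom.hom f) (Hom.hom g) h
  have hf := isRegularEpi_flatMap (B := B) (Hom.hom f)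
  refine ⟨⟨t, ?_, ?_⟩, hom_ext ht⟩
  · rw [← cancel_epi (Hom.hom f), ← Category.assoc, ht, Hom.bd, Hom.bd]
  · rw [← cancel_epi (flatMap (𝟙 B) (Hom.hom f)), ← Category.assoc, ← Hom.equivariant f,
      Category.assoc, ht, flatMap_comp_assoc, ht, Hom.equivariant, Category.comp_id]

section Peiffer

variable (X Y : PXMod B)

/-- A morphism to `X ⋊ Y` that restricts to `j_X` and `i_Y` is a regular epimorphism in `C`, since
`[j_X, i_Y] : X + Y ⟶ X ⋊ Y` factors through it. -/
theorem isRegularEpi_of_comp_eq_sdInl_sdInr {Z : C} (q : Z ⟶ (sdProd X Y).obj) (a : X.obj ⟶ Z)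
    (b : Y.obj ⟶ Z) (ha : a ≫ q = Hom.hom (sdInl X Y)) (hb : b ≫ q = Hom.hom (sdInr X Y)) :
    IsRegularEpi q := by
  have h : coprod.desc a b ≫ q = (X.act.restrict Y.bd).quot := by
    rw [InternalAction.quot_eq, coprod.desc_comp, ha, hb]
    rfl
  have hs : StrongEpi (coprod.desc a b ≫ q) := by
    rw [h]
    exact inferInstanceAs (StrongEpi (X.act.restrict Y.bd).quot)
  have : StrongEpi q := strongEpi_of_strongEpi (coprod.desc a b) q
  infer_instance

instance isRegularEpi_toSdLeft_hom : IsRegularEpi (Hom.hom (toSdLeft X Y)) :=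
  isRegularEpi_of_comp_eq_sdInl_sdInr X Y _ (Hom.hom (coprod.inl : X ⟶ X ⨿ Y))
    (Hom.hom (coprod.inr : Y ⟶ X ⨿ Y)) (by rw [← comp_hom, toSdLeft, coprod.inl_desc])
    (by rw [← comp_hom, toSdLeft, coprod.inr_desc])

instance isRegularEpi_toSdRight_hom : IsRegularEpi (Hom.hom (toSdRight X Y)) :=
  isRegularEpi_of_comp_eq_sdInl_sdInr Y X _ (Hom.hom (coprod.inr : Y ⟶ X ⨿ Y))
    (Hom.hom (coprod.inl : X ⟶ X ⨿ Y)) (by rw [← comp_hom, toSdRight, coprod.inr_desc])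
    (by rw [← comp_hom, toSdRight, coprod.inl_desc])

theorem epi_of_epi_hom {X Y : PXMod B} (f : X ⟶ Y) [Epi (Hom.hom f)] : Epi f :=
  ⟨fun _ _ w => hom_ext ((cancel_epi (Hom.hom f)).1 congr(Hom.hom $w))⟩

instance : Epi (peifferQuot X Y) := by
  have := epi_of_epi_hom (toSdLeft X Y)
  have := epi_of_epi_hom (toSdRight X Y)
  exact epi_comp (toSdLeft X Y) (pushout.inl (toSdLeft X Y) (toSdRight X Y))

variable {X Y}

theorem peifferQuot_comp_eq_desc_iff {A : PXMod B} (m : X ⟶ A) (n : Y ⟶ A)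
    (φ : peifferProduct X Y ⟶ A) : peifferQuot X Y ≫ φ = coprod.desc m n ↔
      peifferInl X Y ≫ φ = m ∧ peifferInr X Y ≫ φ = n := by
  simp only [peifferInl, peifferInr, Category.assoc]
  constructor
  · intro h
    rw [h, coprod.inl_desc, coprod.inr_desc]
    exact ⟨rfl, rfl⟩
  · rintro ⟨h₁, h₂⟩
    ext1
    · rw [h₁, coprod.inl_desc]
    · rw [h₂, coprod.inr_desc]

/-- The universal property of the pushout `X ⋈ Y`, in terms of the diagonal. -/
theorem exists_peifferQuot_comp_eq_iff_factors {A : PXMod B} (g : X ⨿ Y ⟶ A) :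
    (∃ φ : peifferProduct X Y ⟶ A, peifferQuot X Y ≫ φ = g) ↔
      (∃ a, toSdLeft X Y ≫ a = g) ∧ ∃ b, toSdRight X Y ≫ b = g := by
  have hq : peifferQuot X Y = toSdRight X Y ≫ pushout.inr (toSdLeft X Y) (toSdRight X Y) :=
    pushout.condition
  constructor
  · rintro ⟨φ, rfl⟩
    exact ⟨⟨_, (Category.assoc _ _ φ).symm⟩,
      ⟨_, (Category.assoc _ _ φ).symm.trans (congrArg (· ≫ φ) hq.symm)⟩⟩
  · rintro ⟨⟨a, ha⟩, b, hb⟩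
    exact ⟨pushout.desc a b (ha.trans hb.symm), (Category.assoc _ _ _).trans
      ((congrArg (toSdLeft X Y ≫ ·) (pushout.inl_desc a b _)).trans ha)⟩

/-- A morphism factors through `X ⊕ Y ⟶ X ⋈ Y` exactly when it kills the join of the kernels of
the two legs of the pushout. -/
theorem exists_peifferQuot_comp_eq_iff {A : PXMod B} (g : X ⨿ Y ⟶ A) :
    (∃ φ : peifferProduct X Y ⟶ A, peifferQuot X Y ≫ φ = g) ↔
      Hom.hom ((peifferKernel X Y).arrow ≫ g) = 0 := by
  rw [exists_peifferQuot_comp_eq_iff_factors]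
  constructor
  · rintro ⟨⟨a, ha⟩, b, hb⟩
    apply sup_arrow_comp_hom_eq_zero
    · rw [← ha, comp_hom, ← Category.assoc, kerι_comp_hom, zero_comp]
    · rw [← hb, comp_hom, ← Category.assoc, kerι_comp_hom, zero_comp]
  · intro h
    have hker {K : PXMod B} (k : K ⟶ X ⨿ Y) [Mono k] (hk : Subobject.mk k ≤ peifferKernel X Y) :
        Hom.hom k ≫ Hom.hom g = 0 := by
      rw [← comp_hom, ← Subobject.ofMkLE_arrow hk, Category.assoc, comp_hom, h, comp_zero]
    exact ⟨exists_desc_of_kerι_comp (toSdLeft X Y) g (hker _ le_sup_left),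
      exists_desc_of_kerι_comp (toSdRight X Y) g (hker _ le_sup_right)⟩

end Peiffer

end PXMod

end Peiffer

theorem mainTheorem9 {C : Type u} [Category.{v} C] [HasZeroMorphisms C] [Peiffer.SemiAbelian C]
    {B : C} {X Y A : Peiffer.PXMod B} (m : X ⟶ A) (n : Y ⟶ A) [Mono m] [Mono n] :
    (IsZero (Peiffer.PXMod.peifferCommutator m n : Peiffer.PXMod B).obj ↔
      ∃ φ : Peiffer.PXMod.peifferProduct X Y ⟶ A,
        Peiffer.PXMod.peifferInl X Y ≫ φ = m ∧ Peiffer.PXMod.peifferInr X Y ≫ φ = n) ∧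
    ∀ φ ψ : Peiffer.PXMod.peifferProduct X Y ⟶ A,
      (Peiffer.PXMod.peifferInl X Y ≫ φ = m ∧ Peiffer.PXMod.peifferInr X Y ≫ φ = n) →
      (Peiffer.PXMod.peifferInl X Y ≫ ψ = m ∧ Peiffer.PXMod.peifferInr X Y ≫ ψ = n) →
      φ = ψ := by
  refine ⟨?_, fun φ ψ hφ hψ => ?_⟩
  · rw [Peiffer.PXMod.peifferCommutator, Peiffer.PXMod.isZero_imageSubobject_iff,
      ← Peiffer.PXMod.exists_peifferQuot_comp_eq_iff]
    exact exists_congr (Peiffer.PXMod.peifferQuot_comp_eq_desc_iff m n)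
  · rw [← cancel_epi (Peiffer.PXMod.peifferQuot X Y),
      (Peiffer.PXMod.peifferQuot_comp_eq_desc_iff m n φ).2 hφ,
      (Peiffer.PXMod.peifferQuot_comp_eq_desc_iff m n ψ).2 hψ]
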